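/- Let $\alpha,\beta>0$ and let $L\ge 1$ be an integer. Let $\mathcal V$ be the set of real sequences $v=(v(k))_{k\ge 0}$ with $v(0)=1$, $v(k)\ge v(k+1)$ for all $k\ge 0$ and $\lim_{k\to\infty}v(k)=0$. For $v\in\mathcal V$ put $$F_+(v)(k)=\alpha\bigl(v(k-1)^L-v(k)^L\bigr),\qquad F_-(v)(k)=\beta\bigl(v(k)-v(k+1)\bigr)\qquad(k\ge 1),$$ $F_\pm(v)(0)=0$, and $F=F_+-F_-$. Let $w=(w(k))_{k\ge 1}$ be a sequence of positive reals for which there are constants $c,d>0$ such that $c\,w(k+1)\le w(k)\le d\,w(k+1)$ for all $k\ge 1$. Let $L_2(w)$ be the Hilbert space of real sequences $x=(x(k))_{k\ge 0}$ with $x(0)=0$ and $\|x\|_{L_2(w)}^2=\sum_{k\ge 1}x(k)^2w(k)^{-1}<\infty$. Let $u=(u_t)_{t\ge 0}$ be the solution with values in $\mathcal V$ of $\dot u_t(k)=F(u_t)(k)$ ($k\ge 1$, $t\ge 0$), with initial value $u_0\in\mathcal V$ such that $\sum_{k\ge 1}u_0(k)\,w(k)^{-1}<\infty$. Let $M=(M(k))_{k\ge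 0}$ be a family of independent real continuous centered Gaussian martingales, null at time $0$, with deterministic Doob--Meyer brackets $$\langle M(k)\rangle_t=\int_0^t\bigl\{F_+(u_s)(k)+F_-(u_s)(k)\bigr\}\,ds,\qquad t\ge 0 .$$ Then $M$ is a square-integrable martingale in $L_2(w)$: almost surely $M_t\in L_2(w)$ for all $t\ge 0$; up to modification on a null set, $M$ is an $L_2(w)$-valued martingale with respect to the filtration generated by $M$; and $\mathbf E\bigl(\|M_t\|_{L_2(w)}^2\bigr)<\infty$ for every $t\ge 0$. -/

import Mathlib

open MeasureTheory ProbabilityTheory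
open scoped NNReal ENNReal

noncomputable section

/-- The set `𝒱` of tails of probability measures on `ℕ`: nonincreasing real sequences
with `v 0 = 1` and limit `0`. -/
def TailSeq : Set (ℕ → ℝ) :=
  {v | v 0 = 1 ∧ (∀ k, v (k + 1) ≤ v k) ∧ Filter.Tendsto v Filter.atTop (nhds 0)}

/-- `F₊(v)(k) = α (v(k-1)^L - v(k)^L)` for `k ≥ 1`, and `F₊(v)(0) = 0`. -/
def FPlus (α : ℝ) (L : ℕ) (v : ℕ → ℝ) : ℕ → ℝ
  | 0 => 0
  | k + 1 => α * (v k ^ L - v (k + 1) ^ L)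

/-- `F₋(v)(k) = β (v(k) - v(k+1))` for `k ≥ 1`, and `F₋(v)(0) = 0`. -/
def FMinus (β : ℝ) (v : ℕ → ℝ) : ℕ → ℝ
  | 0 => 0
  | k + 1 => β * (v (k + 1) - v (k + 2))

/-- `u` takes values in `𝒱` on `[0, ∞)` and solves `u̇ₜ(k) = F₊(uₜ)(k) - F₋(uₜ)(k)`
for all `t ≥ 0` and `k ≥ 1` (with the one-sided derivative at `t = 0`).
Values of `u` at negative times are irrelevant. -/
structure IsMeanFieldSolution (α β : ℝ) (L : ℕ) (u : ℝ → ℕ → ℝ) : Prop where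
  mem : ∀ t, 0 ≤ t → u t ∈ TailSeq
  deriv : ∀ t, 0 ≤ t → ∀ k, 1 ≤ k →
    HasDerivWithinAt (fun s => u s k) (FPlus α L (u t) k - FMinus β (u t) k) (Set.Ici 0) t

/-- A sequence of positive weights `(w(k))_{k ≥ 1}`. The value at `0` is never used. -/
structure PosWeight where
  toFun : ℕ → ℝ
  pos : ∀ k, 1 ≤ k → 0 < toFun k

instance : CoeFun PosWeight (fun _ => ℕ → ℝ) := ⟨PosWeight.toFun⟩

/-- There are `c, d > 0` with `c w(k+1) ≤ w(k) ≤ d w(k+1)` for all `k ≥ 1`. -/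
def PosWeight.Comparable (w : PosWeight) : Prop :=
  ∃ c d : ℝ, 0 < c ∧ 0 < d ∧ ∀ k, 1 ≤ k → c * w (k + 1) ≤ w k ∧ w k ≤ d * w (k + 1)

/-- `∑_{k ≥ 1} |x(k)| / w(k) < ∞`. -/
def PosWeight.EllOneSummable (w : PosWeight) (x : ℕ → ℝ) : Prop :=
  Summable fun k => |x (k + 1)| / w (k + 1)

namespace PosWeight

lemma pos_succ (w : PosWeight) (k : ℕ) : 0 < w (k + 1) := w.pos _ (Nat.succ_pos k)

/-- `L₂(w)` as a linear subspace of the space of all sequences: `x(0) = 0` and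
`∑_{k ≥ 1} x(k)² / w(k) < ∞`. -/
def L2Submodule (w : PosWeight) : Submodule ℝ (ℕ → ℝ) where
  carrier := {x | x 0 = 0 ∧ Summable fun k => x (k + 1) ^ 2 / w (k + 1)}
  zero_mem' := by simp
  add_mem' := by
    rintro x y ⟨hx, hx'⟩ ⟨hy, hy'⟩
    refine ⟨by simp [hx, hy], ?_⟩
    refine Summable.of_nonneg_of_le (fun k => ?_) (fun k => ?_)
      ((hx'.mul_left 2).add (hy'.mul_left 2))
    · exact div_nonneg (sq_nonneg _) (w.pos_succ k).le
    · have h : (x (k + 1) + y (k + 1)) ^ 2 ≤ 2 * x (k + 1) ^ 2 + 2 * y (k + 1) ^ 2 := by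
        nlinarith [sq_nonneg (x (k + 1) - y (k + 1))]
      calc (x + y) (k + 1) ^ 2 / w (k + 1)
          ≤ (2 * x (k + 1) ^ 2 + 2 * y (k + 1) ^ 2) / w (k + 1) :=
            div_le_div_of_nonneg_right h (w.pos_succ k).le
        _ = _ := by ring
  smul_mem' := by
    rintro a x ⟨hx, hx'⟩
    refine ⟨by simp [hx], (hx'.mul_left (a ^ 2)).congr fun k => ?_⟩
    simp only [Pi.smul_apply, smul_eq_mul]
    ring

/-- The Hilbert space `L₂(w)`. It is a type of its own, so that its topology is the
one of its norm and not the product topology of the space of sequences. -/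
def L2 (w : PosWeight) : Type := w.L2Submodule

variable {w : PosWeight}

instance : AddCommGroup w.L2 := inferInstanceAs (AddCommGroup w.L2Submodule)

instance : Module ℝ w.L2 := inferInstanceAs (Module ℝ w.L2Submodule)

instance : CoeFun w.L2 (fun _ => ℕ → ℝ) := ⟨fun x => Subtype.val x⟩

namespace L2

lemma add_apply (x y : w.L2) (k : ℕ) : (x + y) k = x k + y k := rfl

lemma smul_apply (a : ℝ) (x : w.L2) (k : ℕ) : (a • x) k = a * x k := rfl

lemma apply_zero (x : w.L2) : x 0 = 0 := (Subtype.property x).1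

lemma summable_sq (x : w.L2) : Summable fun k => x (k + 1) ^ 2 / w (k + 1) :=
  (Subtype.property x).2

lemma summable_mul (x y : w.L2) : Summable fun k => x (k + 1) * y (k + 1) / w (k + 1) := by
  refine Summable.of_norm_bounded (x.summable_sq.add y.summable_sq) fun k => ?_
  rw [Real.norm_eq_abs, abs_div, abs_of_pos (w.pos_succ k), ← add_div]
  refine div_le_div_of_nonneg_right ?_ (w.pos_succ k).le
  rw [abs_le]
  constructor <;> nlinarith [sq_nonneg (x (k + 1) - y (k + 1)), sq_nonneg (x (k + 1) + y (k + 1)),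
    sq_nonneg (x (k + 1)), sq_nonneg (y (k + 1))]

/-- The inner product `⟨x, y⟩ = ∑_{k ≥ 1} x(k) y(k) / w(k)` of `L₂(w)`. -/
abbrev core (w : PosWeight) : InnerProductSpace.Core ℝ w.L2 where
  inner x y := ∑' k, x (k + 1) * y (k + 1) / w (k + 1)
  conj_inner_symm x y := by simp [mul_comm]
  re_inner_nonneg x := by
    simp only [RCLike.re_to_real]
    exact tsum_nonneg fun k => div_nonneg (mul_self_nonneg _) (w.pos_succ k).le
  add_left x y z := by
    rw [← (summable_mul x z).tsum_add (summable_mul y z)]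
    exact tsum_congr fun k => by rw [add_apply]; ring
  smul_left x y a := by
    simp only [conj_trivial]
    rw [← tsum_mul_left]
    exact tsum_congr fun k => by rw [smul_apply]; ring
  definite x hx := by
    have h0 : ∀ k, 0 ≤ x (k + 1) * x (k + 1) / w (k + 1) := fun k =>
      div_nonneg (mul_self_nonneg _) (w.pos_succ k).le
    have h1 := ((summable_mul x x).hasSum_iff.2 hx)
    have h2 := (hasSum_zero_iff_of_nonneg h0).1 h1
    refine Subtype.ext (funext fun k => ?_)
    cases k with
    | zero => exact x.apply_zero
    | succ k =>
      have h3 := congrFun h2 k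
      simp only [Pi.zero_apply, div_eq_zero_iff, (w.pos_succ k).ne', or_false] at h3
      exact mul_self_eq_zero.1 h3

instance : NormedAddCommGroup w.L2 := (core w).toNormedAddCommGroup

instance : InnerProductSpace ℝ w.L2 := InnerProductSpace.ofCore (core w).toCore

/-- `‖x‖² = ∑_{k ≥ 1} x(k)² / w(k)`. -/
lemma norm_sq_eq (x : w.L2) : ‖x‖ ^ 2 = ∑' k, x (k + 1) ^ 2 / w (k + 1) := by
  rw [← real_inner_self_eq_norm_sq]
  exact tsum_congr fun k => by rw [pow_two]

/-- The isometry `x ↦ (x(k+1) / √w(k+1))_{k ≥ 0}` onto the unweighted space `ℓ²`. -/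
def toEllTwo (w : PosWeight) : w.L2 →ₗᵢ[ℝ] lp (fun _ : ℕ => ℝ) 2 where
  toFun x := ⟨fun k => x (k + 1) / √(w (k + 1)), by
    refine memℓp_gen (x.summable_sq.congr fun k => ?_)
    simp [div_pow, Real.sq_sqrt (w.pos_succ k).le]⟩
  map_add' x y := by
    ext k
    exact add_div _ _ _
  map_smul' a x := by
    ext k
    exact mul_div_assoc _ _ _
  norm_map' x := by
    rw [← sq_eq_sq₀ (norm_nonneg _) (norm_nonneg _), norm_sq_eq,
      ← real_inner_self_eq_norm_sq, lp.inner_eq_tsum]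
    refine tsum_congr fun k => ?_
    simp [div_pow, Real.sq_sqrt (w.pos_succ k).le]

lemma toEllTwo_surjective : Function.Surjective (toEllTwo w) := by
  intro y
  have hy := (lp.memℓp y).summable (by simp)
  refine ⟨⟨fun k => Nat.casesOn k 0 fun k => y k * √(w (k + 1)), rfl, ?_⟩, ?_⟩
  · refine hy.congr fun k => ?_
    simp [mul_pow, Real.sq_sqrt (w.pos_succ k).le, (w.pos_succ k).ne']
  · ext k
    exact mul_div_cancel_right₀ _ (Real.sqrt_pos.2 (w.pos_succ k)).ne'

instance : CompleteSpace w.L2 :=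
  ((toEllTwo w).isometry.isUniformInducing.completeSpace_congr toEllTwo_surjective).2 inferInstance

end L2

end PosWeight

/-- `M = (M(k))_{k ≥ 0}` is a family of independent real continuous centered Gaussian
martingales, null at time `0`, with the deterministic Doob–Meyer brackets
`⟨M(k)⟩ₜ = ∫₀ᵗ (F₊(uₛ)(k) + F₋(uₛ)(k)) ds`, that is, `M(k)² - ⟨M(k)⟩` is a martingale.
The martingale properties of `M(k)` refer to the filtration generated by `M(k)`. -/
structure IsLimitMartingale {Ω : Type*} [MeasurableSpace Ω] (P : Measure Ω)
    (α β : ℝ) (L : ℕ) (u : ℝ → ℕ → ℝ) (M : ℕ → ℝ≥0 → Ω → ℝ) : Prop where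
  stronglyMeasurable : ∀ k t, StronglyMeasurable (M k t)
  indep : iIndepFun (fun k ω t => M k t ω) P
  continuous : ∀ k, ∀ᵐ ω ∂P, Continuous fun t => M k t ω
  gaussian : ∀ k, IsGaussianProcess (M k) P
  centered : ∀ k t, ∫ ω, M k t ω ∂P = 0
  null_at_zero : ∀ k, ∀ᵐ ω ∂P, M k 0 ω = 0
  martingale : ∀ k, Martingale (M k) (Filtration.natural (M k) (stronglyMeasurable k)) P
  bracket : ∀ k, Martingale
    (fun t ω => M k t ω ^ 2 - ∫ s in (0 : ℝ)..t, (FPlus α L (u s) k + FMinus β (u s) k))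
    (Filtration.natural (M k) (stronglyMeasurable k)) P

/-- The filtration generated by the whole family `M = (M(k))_{k ≥ 0}`. -/
def jointFiltration {Ω : Type*} [mΩ : MeasurableSpace Ω] (M : ℕ → ℝ≥0 → Ω → ℝ)
    (hM : ∀ k t, StronglyMeasurable (M k t)) : Filtration ℝ≥0 mΩ :=
  Filtration.natural (fun t ω k => M k t ω)
    (fun t => (measurable_pi_lambda _ fun k => (hM k t).measurable).stronglyMeasurable)

end

/-!
Each `M(k)` is a martingale for its own filtration; since the remaining coordinates are independent
of the whole path of `M(k)`, adjoining them does not change conditional expectations, and `M(k)` is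
a martingale for the joint filtration.

The bracket gives `E M(k)ₜ² = ∫₀ᵗ (F₊ + F₋)(uₛ)(k) ds`. As `v ∈ 𝒱` satisfies
`|F₊(v)(k)| ≤ |α| v(k-1)` and `|F₋(v)(k)| ≤ |β| v(k)`, and `w(k) ≤ d w(k+1)`, Grönwall's lemma
applied to the partial sums of the weighted `ℓ¹` norm of `u` bounds that norm on bounded time
intervals, and hence `∑ E M(k)ₜ² / w(k) < ∞`.

The partial sums of `∑ M(k)ₜ² / w(k)` form an increasing sequence of continuous nonnegative
submartingales bounded in `L¹`, so by Doob's maximal inequality they are almost surely bounded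
uniformly over each interval `[0, T]`: one null set serves all times. On its complement the series
of the coordinates along an orthonormal basis defines `M` as an element of `L₂(w)`, and the
martingale property, being a countable family of scalar identities, is checked coordinatewise.
-/

section CondExp

variable {Ω E : Type*} [NormedAddCommGroup E] [NormedSpace ℝ E]
  {m n G mΩ : MeasurableSpace Ω} {P : Measure Ω} {f : Ω → E}

lemma isPiSystem_inter_measurableSet (m G : MeasurableSpace Ω) :
    IsPiSystem {s : Set Ω | ∃ A B, MeasurableSet[m] A ∧ MeasurableSet[G] B ∧ s = A ∩ B} := by
  rintro _ ⟨A, B, hA, hB, rfl⟩ _ ⟨C, D, hC, hD, rfl⟩ -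
  exact ⟨A ∩ C, B ∩ D, hA.inter hC, hB.inter hD, Set.inter_inter_inter_comm A B C D⟩

lemma sup_eq_generateFrom_inter (m G : MeasurableSpace Ω) :
    m ⊔ G = MeasurableSpace.generateFrom
      {s : Set Ω | ∃ A B, MeasurableSet[m] A ∧ MeasurableSet[G] B ∧ s = A ∩ B} := by
  refine le_antisymm (sup_le (fun A hA => ?_) (fun B hB => ?_))
    (MeasurableSpace.generateFrom_le ?_)
  · exact MeasurableSpace.measurableSet_generateFrom ⟨A, Set.univ, hA, .univ, by simp⟩
  · exact MeasurableSpace.measurableSet_generateFrom ⟨Set.univ, B, .univ, hB, by simp⟩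
  · rintro _ ⟨A, B, hA, hB, rfl⟩
    exact MeasurableSet.inter (le_sup_left (a := m) (b := G) _ hA)
      (le_sup_right (a := m) (b := G) _ hB)

lemma setIntegral_eq_of_setIntegral_inter_eq {g : Ω → E} (hm : m ≤ mΩ)
    (hG : G ≤ mΩ) (hf : Integrable f P) (hg : Integrable g P)
    (hfg : ∀ A B, MeasurableSet[m] A → MeasurableSet[G] B →
      ∫ ω in A ∩ B, f ω ∂P = ∫ ω in A ∩ B, g ω ∂P)
    {s : Set Ω} (hs : MeasurableSet[m ⊔ G] s) : ∫ ω in s, f ω ∂P = ∫ ω in s, g ω ∂P := by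
  have hmG : m ⊔ G ≤ mΩ := sup_le hm hG
  induction s, hs using MeasurableSpace.induction_on_inter (sup_eq_generateFrom_inter m G)
    (isPiSystem_inter_measurableSet m G) with
  | empty => simp
  | basic s hs =>
    obtain ⟨A, B, hA, hB, rfl⟩ := hs
    exact hfg A B hA hB
  | compl s hs ih =>
    have huniv : ∫ ω, f ω ∂P = ∫ ω, g ω ∂P := by simpa using hfg .univ .univ .univ .univ
    rw [setIntegral_compl (hmG _ hs) hf, setIntegral_compl (hmG _ hs) hg, ih, huniv]
  | iUnion s hd hs ih =>
    rw [integral_iUnion (fun i => hmG _ (hs i)) hd hf.integrableOn,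
      integral_iUnion (fun i => hmG _ (hs i)) hd hg.integrableOn]
    exact tsum_congr ih

variable [CompleteSpace E] [IsFiniteMeasure P]

lemma setIntegral_inter_of_indep (hn : n ≤ mΩ) (hG : G ≤ mΩ) (hind : Indep n G P)
    (hf : StronglyMeasurable[n] f) (hfi : Integrable f P) {A B : Set Ω}
    (hA : MeasurableSet[n] A) (hB : MeasurableSet[G] B) :
    ∫ ω in A ∩ B, f ω ∂P = P.real B • ∫ ω in A, f ω ∂P := by
  rw [Set.inter_comm, ← setIntegral_indicator (hn _ hA),
    ← setIntegral_condExp hG (hfi.indicator (hn _ hA)) hB,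
    setIntegral_congr_ae (hG _ hB)
      ((condExp_indep_eq hn hG (hf.indicator hA) hind).mono fun _ h _ => h),
    setIntegral_const, integral_indicator (hn _ hA)]

lemma condExp_sup_of_indep (hmn : m ≤ n) (hn : n ≤ mΩ) (hG : G ≤ mΩ) (hind : Indep n G P)
    (hf : StronglyMeasurable[n] f) (hfi : Integrable f P) : P[f | m ⊔ G] =ᵐ[P] P[f | m] := by
  have hm : m ≤ mΩ := hmn.trans hn
  have hrect : ∀ A B, MeasurableSet[m] A → MeasurableSet[G] B →
      ∫ ω in A ∩ B, (P[f | m]) ω ∂P = ∫ ω in A ∩ B, f ω ∂P := fun A B hA hB => by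
    rw [setIntegral_inter_of_indep hn hG hind (stronglyMeasurable_condExp.mono hmn)
      integrable_condExp (hmn _ hA) hB,
      setIntegral_inter_of_indep hn hG hind hf hfi (hmn _ hA) hB, setIntegral_condExp hm hfi hA]
  exact (ae_eq_condExp_of_forall_setIntegral_eq (sup_le hm hG) hfi
    (fun _ _ _ => integrable_condExp.integrableOn)
    (fun s hs _ => setIntegral_eq_of_setIntegral_inter_eq hm hG integrable_condExp hfi hrect hs)
    (stronglyMeasurable_condExp.mono (le_sup_left : m ≤ m ⊔ G)).aestronglyMeasurable).symm

lemma martingale_of_le_sup_of_indep {ι : Type*} [Preorder ι] {ℱ 𝒢 : Filtration ι mΩ}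
    {f : ι → Ω → E} (hf : Martingale f ℱ P) (hℱ : ∀ t, ℱ t ≤ n) (hn : n ≤ mΩ) (hG : G ≤ mΩ)
    (hind : Indep n G P) (hle : ∀ t, ℱ t ≤ 𝒢 t) (hsup : ∀ t, 𝒢 t ≤ ℱ t ⊔ G) :
    Martingale f 𝒢 P := by
  refine ⟨fun t => (hf.stronglyAdapted t).mono (hle t), fun s t hst => ?_⟩
  have hcond : P[f t | ℱ s ⊔ G] =ᵐ[P] f s :=
    (condExp_sup_of_indep (hℱ s) hn hG hind ((hf.stronglyAdapted t).mono (hℱ t))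
      (hf.integrable t)).trans (hf.condExp_ae_eq hst)
  calc P[f t | 𝒢 s]
      =ᵐ[P] P[P[f t | ℱ s ⊔ G] | 𝒢 s] :=
        (condExp_condExp_of_le (hsup s) (sup_le (ℱ.le s) hG)).symm
    _ =ᵐ[P] P[f s | 𝒢 s] := condExp_congr_ae hcond
    _ = f s := condExp_of_stronglyMeasurable (𝒢.le s) ((hf.stronglyAdapted s).mono (hle s))
        (hf.integrable s)

end CondExp

section JointFiltration

variable {Ω : Type*} [mΩ : MeasurableSpace Ω] {M : ℕ → ℝ≥0 → Ω → ℝ}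
  (hM : ∀ k t, StronglyMeasurable (M k t))

lemma jointFiltration_eq_iSup_natural (t : ℝ≥0) :
    jointFiltration M hM t = ⨆ k, Filtration.natural (M k) (hM k) t := by
  have hcomap (r : ℝ≥0) : MeasurableSpace.comap (fun ω k => M k r ω) MeasurableSpace.pi =
      ⨆ k, MeasurableSpace.comap (M k r) inferInstance :=
    MeasurableSpace.comap_process_pi fun k => M k r
  calc jointFiltration M hM t
      = ⨆ r, ⨆ _ : r ≤ t, MeasurableSpace.comap (fun ω k => M k r ω) MeasurableSpace.pi := rfl
    _ = ⨆ r, ⨆ _ : r ≤ t, ⨆ k, MeasurableSpace.comap (M k r) inferInstance := by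
        simp only [hcomap]
    _ = ⨆ k, ⨆ r, ⨆ _ : r ≤ t, MeasurableSpace.comap (M k r) inferInstance :=
        (iSup_congr fun _ => iSup_comm).trans iSup_comm
    _ = ⨆ k, Filtration.natural (M k) (hM k) t := rfl

lemma natural_le_jointFiltration (k : ℕ) (t : ℝ≥0) :
    Filtration.natural (M k) (hM k) t ≤ jointFiltration M hM t := by
  rw [jointFiltration_eq_iSup_natural]
  exact le_iSup (fun k => Filtration.natural (M k) (hM k) t) k

lemma natural_le_comap_path (k : ℕ) (t : ℝ≥0) :
    Filtration.natural (M k) (hM k) t ≤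
      MeasurableSpace.comap (fun ω r => M k r ω) MeasurableSpace.pi := by
  rw [show MeasurableSpace.comap (fun ω r => M k r ω) MeasurableSpace.pi =
    ⨆ r, MeasurableSpace.comap (M k r) inferInstance from MeasurableSpace.comap_process_pi (M k)]
  exact iSup₂_le fun r _ => le_iSup (fun r => MeasurableSpace.comap (M k r) inferInstance) r

lemma jointFiltration_le_sup_comap_path (k : ℕ) (t : ℝ≥0) :
    jointFiltration M hM t ≤ Filtration.natural (M k) (hM k) t ⊔
      ⨆ j ∈ ({k}ᶜ : Set ℕ),
        MeasurableSpace.comap (fun ω r => M j r ω) MeasurableSpace.pi := by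
  rw [jointFiltration_eq_iSup_natural]
  refine iSup_le fun j => ?_
  rcases eq_or_ne j k with rfl | hjk
  · exact le_sup_left
  · exact (natural_le_comap_path hM j t).trans (le_sup_of_le_right
      (le_iSup₂ (f := fun j (_ : j ∈ ({k}ᶜ : Set ℕ)) =>
        MeasurableSpace.comap (fun ω r => M j r ω) MeasurableSpace.pi) j hjk))

lemma martingale_jointFiltration {E : Type*} [NormedAddCommGroup E] [NormedSpace ℝ E]
    [CompleteSpace E] {P : Measure Ω} [IsFiniteMeasure P]
    (hindep : iIndepFun (fun k ω t => M k t ω) P) {k : ℕ} {f : ℝ≥0 → Ω → E}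
    (hf : Martingale f (Filtration.natural (M k) (hM k)) P) :
    Martingale f (jointFiltration M hM) P := by
  have hpath : ∀ j, MeasurableSpace.comap (fun ω r => M j r ω) MeasurableSpace.pi ≤ mΩ :=
    fun j => (measurable_pi_lambda _ fun r => (hM j r).measurable).comap_le
  have hothers := indep_iSup_of_disjoint hpath hindep.iIndep
    (S := {k}) (T := {k}ᶜ) disjoint_compl_right
  simp only [Set.mem_singleton_iff, iSup_iSup_eq_left] at hothers
  exact martingale_of_le_sup_of_indep hf (natural_le_comap_path hM k) (hpath k)
    (iSup₂_le fun j _ => hpath j) hothers (natural_le_jointFiltration hM k)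
    (jointFiltration_le_sup_comap_path hM k)

end JointFiltration

section MaximalInequality

variable {Ω ι : Type*} {mΩ : MeasurableSpace Ω} {P : Measure Ω}

lemma submartingale_finsetSum {κ : Type*} [Preorder ι] {ℱ : Filtration ι mΩ}
    {f : κ → ι → Ω → ℝ} (s : Finset κ) (hf : ∀ k ∈ s, Submartingale (f k) ℱ P) :
    Submartingale (∑ k ∈ s, f k) ℱ P :=
  Finset.sum_induction f (Submartingale · ℱ P) (fun _ _ => Submartingale.add)
    (martingale_zero ℝ ℱ P).submartingale hf

lemma submartingale_comp_monotone {κ : Type*} [Preorder ι] [Preorder κ] {ℱ : Filtration ι mΩ}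
    {f : ι → Ω → ℝ} (hf : Submartingale f ℱ P) {τ : κ → ι} (hτ : Monotone τ) :
    Submartingale (fun i => f (τ i))
      ⟨fun i => ℱ (τ i), fun _ _ hij => ℱ.mono (hτ hij), fun i => ℱ.le (τ i)⟩ P :=
  ⟨fun i => hf.stronglyAdapted (τ i), fun _ _ hij => hf.ae_le_condExp (hτ hij),
    fun i => hf.integrable (τ i)⟩

lemma exists_monotone_enumeration [LinearOrder ι] {T : ι} (S : Finset ι) (hS : ∀ t ∈ S, t ≤ T) :
    ∃ τ : ℕ → ι, Monotone τ ∧ τ S.card = T ∧ ∀ t ∈ S, ∃ i ≤ S.card, τ i = t := by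
  let τ : ℕ → ι := fun i => if h : i < S.card then S.orderEmbOfFin rfl ⟨i, h⟩ else T
  refine ⟨τ, fun i j hij => ?_, by simp [τ], fun t ht => ?_⟩
  · by_cases hj : j < S.card
    · simpa [τ, hj, hij.trans_lt hj] using hij
    · by_cases hi : i < S.card
      · simpa [τ, hi, hj] using hS _ (S.orderEmbOfFin_mem rfl ⟨i, hi⟩)
      · simp [τ, hi, hj]
  · obtain ⟨i, rfl⟩ : t ∈ Set.range (S.orderEmbOfFin rfl) := by simpa using ht
    exact ⟨i, i.2.le, by simp [τ]⟩

lemma measure_iInter_eq_zero_of_mul_le {A : ℕ → Set Ω} {C : ℝ≥0∞} (hC : C ≠ ∞)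
    (hA : ∀ N : ℕ, N * P (A N) ≤ C) : P (⋂ N, A N) = 0 := by
  by_contra hne
  obtain ⟨N, hN⟩ := ENNReal.exists_nat_mul_gt hne hC
  exact hN.not_ge ((mul_le_mul_right (measure_mono (Set.iInter_subset A N)) _).trans (hA N))

variable [IsFiniteMeasure P]

lemma submartingale_convexOn_comp {E : Type*} [NormedAddCommGroup E] [NormedSpace ℝ E]
    [CompleteSpace E] [Preorder ι] {ℱ : Filtration ι mΩ} {f : ι → Ω → E} {φ : E → ℝ}
    (hf : Martingale f ℱ P) (hφ : ConvexOn ℝ Set.univ φ) (hφc : Continuous φ)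
    (hφf : ∀ t, Integrable (φ ∘ f t) P) : Submartingale (fun t => φ ∘ f t) ℱ P := by
  refine ⟨fun t => hφc.comp_stronglyMeasurable (hf.stronglyAdapted t), fun s t hst => ?_, hφf⟩
  filter_upwards [hf.condExp_ae_eq hst,
    hφ.map_condExp_le_univ (ℱ.le s) hφc.lowerSemicontinuous (hf.integrable t) (hφf t)]
    with ω hcond hjensen
  simpa only [Function.comp_apply, hcond] using hjensen

lemma mul_measure_exists_mem_finset_le [LinearOrder ι] {ℱ : Filtration ι mΩ} {f : ι → Ω → ℝ}
    (hf : Submartingale f ℱ P) (h0 : 0 ≤ f) {T : ι} (S : Finset ι) (hS : ∀ t ∈ S, t ≤ T)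
    (ε : ℝ≥0) :
    ε * P {ω | ∃ t ∈ S, (ε : ℝ) ≤ f t ω} ≤ ENNReal.ofReal (∫ ω, f T ω ∂P) := by
  obtain ⟨τ, hτ, hτT, hτS⟩ := exists_monotone_enumeration S hS
  have hsubset : {ω | ∃ t ∈ S, (ε : ℝ) ≤ f t ω} ⊆
      {ω | (ε : ℝ) ≤ (Finset.range (S.card + 1)).sup' Finset.nonempty_range_add_one
        fun i => f (τ i) ω} := by
    rintro ω ⟨t, ht, hε⟩
    obtain ⟨i, hi, rfl⟩ := hτS t ht
    exact hε.trans (Finset.le_sup' (fun i => f (τ i) ω) (Finset.mem_range_succ_iff.2 hi))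
  refine (mul_le_mul_right (measure_mono hsubset) _).trans
    ((maximal_ineq (submartingale_comp_monotone hf hτ) (fun i => h0 (τ i)) S.card).trans ?_)
  rw [hτT]
  exact ENNReal.ofReal_le_ofReal
    (setIntegral_le_integral (hf.integrable T) (ae_of_all _ (h0 T)))

variable [LinearOrder ι] {ℱ : Filtration ι mΩ} {Q : ℕ → ι → Ω → ℝ}

-- Testing `Q n` at the first `n` sample points only makes the exceptional events increase in `n`,
-- so that the maximal inequality carries over to their union.
lemma ae_exists_forall_seq_lt (hsub : ∀ n, Submartingale (Q n) ℱ P) (h0 : 0 ≤ Q)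
    (hmono : Monotone Q) {T : ι} {C : ℝ} (hC : ∀ n, ∫ ω, Q n T ω ∂P ≤ C) {τ : ℕ → ι}
    (hτ : ∀ i, τ i ≤ T) : ∀ᵐ ω ∂P, ∃ N : ℕ, ∀ n i, Q n (τ i) ω < N := by
  classical
  let A : ℕ → ℕ → Set Ω := fun N n => {ω | ∃ t ∈ (Finset.range n).image τ, (N : ℝ) ≤ Q n t ω}
  have hAmono : ∀ N, Monotone (A N) := fun N m n hmn ω ⟨t, ht, hN⟩ =>
    ⟨t, Finset.image_subset_image (Finset.range_mono hmn) ht, hN.trans (hmono hmn t ω)⟩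
  have hA : ∀ N : ℕ, N * P (⋃ n, A N n) ≤ ENNReal.ofReal C := fun N => by
    rw [(hAmono N).measure_iUnion, ENNReal.mul_iSup]
    refine iSup_le fun n => le_trans ?_ (ENNReal.ofReal_le_ofReal (hC n))
    have hτT : ∀ t ∈ (Finset.range n).image τ, t ≤ T := by simpa using fun i _ => hτ i
    simpa [A] using mul_measure_exists_mem_finset_le (hsub n) (h0 n) _ hτT N
  filter_upwards [measure_eq_zero_iff_ae_notMem.1
    (measure_iInter_eq_zero_of_mul_le ENNReal.ofReal_ne_top hA)] with ω hω
  simp only [Set.mem_iInter, Set.mem_iUnion, not_forall, not_exists] at hω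
  obtain ⟨N, hN⟩ := hω
  refine ⟨N, fun n i => lt_of_not_ge fun hle => hN (max n (i + 1)) ⟨τ i, ?_, ?_⟩⟩
  · exact Finset.mem_image_of_mem τ (Finset.mem_range.2 (by omega))
  · exact hle.trans (hmono (le_max_left n (i + 1)) (τ i) ω)

lemma ae_exists_forall_le_of_submartingale [TopologicalSpace ι] [SecondCountableTopology ι]
    (hsub : ∀ n, Submartingale (Q n) ℱ P) (h0 : 0 ≤ Q) (hmono : Monotone Q) {T : ι}
    (hcont : ∀ᵐ ω ∂P, ∀ n, ContinuousOn (fun t => Q n t ω) (Set.Iic T)) {C : ℝ}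
    (hC : ∀ n, ∫ ω, Q n T ω ∂P ≤ C) : ∀ᵐ ω ∂P, ∃ B : ℝ, ∀ n, ∀ t ≤ T, Q n t ω ≤ B := by
  have : Nonempty (Set.Iic T) := ⟨⟨T, le_rfl⟩⟩
  have hdense := TopologicalSpace.denseRange_denseSeq (Set.Iic T)
  filter_upwards [hcont, ae_exists_forall_seq_lt hsub h0 hmono hC
    fun i => (TopologicalSpace.denseSeq (Set.Iic T) i).2] with ω hω ⟨N, hN⟩
  refine ⟨N, fun n t ht => ?_⟩
  exact hdense.induction_on (p := fun t : Set.Iic T => Q n t ω ≤ N) ⟨t, ht⟩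
    (isClosed_le (hω n).domRestrict continuous_const) fun i => (hN n i).le

end MaximalInequality

section HilbertBasis

variable {κ E : Type*} [NormedAddCommGroup E] [InnerProductSpace ℝ E] (b : HilbertBasis κ ℝ E)

lemma repr_tsum_smul {y : κ → ℝ} (hy : Summable fun k => y k ^ 2) (k : κ) :
    b.repr (∑' j, y j • b j) k = y k := by
  have hmem : Memℓp y 2 := memℓp_gen (by simpa using hy)
  rw [(b.hasSum_repr_symm ⟨y, hmem⟩).tsum_eq, LinearIsometryEquiv.apply_symm_apply]

lemma hasSum_repr_sq (x : E) : HasSum (fun k => b.repr x k ^ 2) (‖x‖ ^ 2) := by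
  rw [← real_inner_self_eq_norm_sq]
  refine (b.hasSum_inner_mul_inner x x).congr_fun fun k => ?_
  rw [b.repr_apply_apply, real_inner_comm x, sq]

variable [Countable κ] {Ω : Type*} {mΩ : MeasurableSpace Ω} {P : Measure Ω}

lemma memLp_two_of_summable_integral_repr_sq {X : Ω → E} (hX : AEStronglyMeasurable X P)
    (hint : ∀ k, Integrable (fun ω => b.repr (X ω) k ^ 2) P)
    (hsum : Summable fun k => ∫ ω, b.repr (X ω) k ^ 2 ∂P) : MemLp X 2 P := by
  rw [memLp_two_iff_integrable_sq_norm hX]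
  refine ⟨hX.norm.pow 2, (hasFiniteIntegral_iff_ofReal (ae_of_all _ fun ω => sq_nonneg _)).2 ?_⟩
  calc ∫⁻ ω, ENNReal.ofReal (‖X ω‖ ^ 2) ∂P
      = ∫⁻ ω, ∑' k, ENNReal.ofReal (b.repr (X ω) k ^ 2) ∂P := by
        refine lintegral_congr fun ω => ?_
        rw [← (hasSum_repr_sq b (X ω)).tsum_eq,
          ENNReal.ofReal_tsum_of_nonneg (fun k => sq_nonneg _) (hasSum_repr_sq b (X ω)).summable]
    _ = ∑' k, ∫⁻ ω, ENNReal.ofReal (b.repr (X ω) k ^ 2) ∂P :=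
        lintegral_tsum fun k => (hint k).aemeasurable.ennreal_ofReal
    _ = ∑' k, ENNReal.ofReal (∫ ω, b.repr (X ω) k ^ 2 ∂P) :=
        tsum_congr fun k => (ofReal_integral_eq_lintegral_ofReal (hint k)
          (ae_of_all _ fun ω => sq_nonneg _)).symm
    _ < ∞ := hsum.tsum_ofReal_lt_top

variable [CompleteSpace E]

lemma stronglyMeasurable_tsum_smul {_ : MeasurableSpace Ω}
    {Y : κ → Ω → ℝ} (hY : ∀ k, StronglyMeasurable (Y k)) :
    StronglyMeasurable fun ω => ∑' k, Y k ω • b k :=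
  StronglyMeasurable.tsum fun k => (hY k).smul_const (b k)

lemma martingale_of_repr {ι : Type*} [Preorder ι] {ℱ : Filtration ι mΩ} {X : ι → Ω → E}
    (hX : StronglyAdapted ℱ X) (hint : ∀ t, Integrable (X t) P)
    (hcoord : ∀ k, Martingale (fun t ω => b.repr (X t ω) k) ℱ P) : Martingale X ℱ P := by
  refine ⟨hX, fun s t hst => ?_⟩
  have hcondExp : ∀ k, ∀ᵐ ω ∂P, b.repr ((P[X t | ℱ s]) ω) k = b.repr (X s ω) k := fun k => by
    simp only [b.repr_apply_apply] at hcoord ⊢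
    exact ((innerSL ℝ (b k)).comp_condExp_comm (hint t)).trans ((hcoord k).condExp_ae_eq hst)
  filter_upwards [ae_all_iff.2 hcondExp] with ω hω
  exact b.repr.injective (lp.ext (funext hω))

end HilbertBasis

section HilbertMartingale

variable {Ω ι : Type*} {mΩ : MeasurableSpace Ω} {P : Measure Ω} [IsFiniteMeasure P]
  [LinearOrder ι] [TopologicalSpace ι] [SecondCountableTopology ι]
  {ℱ : Filtration ι mΩ} {Y : ℕ → ι → Ω → ℝ}

lemma ae_forall_le_summable_sq (hY : ∀ k, Martingale (Y k) ℱ P)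
    (hsq : ∀ k t, Integrable (fun ω => Y k t ω ^ 2) P) {T : ι}
    (hcont : ∀ᵐ ω ∂P, ∀ k, ContinuousOn (fun t => Y k t ω) (Set.Iic T))
    (hsum : Summable fun k => ∫ ω, Y k T ω ^ 2 ∂P) :
    ∀ᵐ ω ∂P, ∀ t ≤ T, Summable fun k => Y k t ω ^ 2 := by
  let S : ℕ → ι → Ω → ℝ := fun n => ∑ k ∈ Finset.range n, fun t => (· ^ 2) ∘ Y k t
  have hS : ∀ n t ω, S n t ω = ∑ k ∈ Finset.range n, Y k t ω ^ 2 := by simp [S]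
  have hsub : ∀ n, Submartingale (S n) ℱ P := fun n =>
    submartingale_finsetSum _ fun k _ => submartingale_convexOn_comp (hY k)
      even_two.convexOn_pow (continuous_pow 2) (hsq k)
  have hS0 : 0 ≤ S := fun n t ω => (hS n t ω).symm ▸ Finset.sum_nonneg fun k _ => sq_nonneg _
  have hmono : Monotone S := monotone_nat_of_le_succ fun n t ω => by
    simpa only [hS, Finset.sum_range_succ] using le_add_of_nonneg_right (sq_nonneg (Y n t ω))
  have hScont : ∀ᵐ ω ∂P, ∀ n, ContinuousOn (fun t => S n t ω) (Set.Iic T) := by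
    filter_upwards [hcont] with ω hω n
    simp only [hS]
    exact continuousOn_finsetSum _ fun k _ => (hω k).pow 2
  have hSint : ∀ n, ∫ ω, S n T ω ∂P ≤ ∑' k, ∫ ω, Y k T ω ^ 2 ∂P := fun n => by
    simp only [hS]
    rw [integral_finsetSum _ fun k _ => hsq k T]
    exact hsum.sum_le_tsum _ fun k _ => integral_nonneg fun ω => sq_nonneg _
  filter_upwards [ae_exists_forall_le_of_submartingale hsub hS0 hmono hScont hSint]
    with ω ⟨B, hB⟩ t ht
  exact summable_of_sum_range_le (fun k => sq_nonneg _) fun n => hS n t ω ▸ hB n t ht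

variable [Nonempty ι] [(Filter.atTop : Filter ι).IsCountablyGenerated]

lemma ae_forall_summable_sq (hY : ∀ k, Martingale (Y k) ℱ P)
    (hsq : ∀ k t, Integrable (fun ω => Y k t ω ^ 2) P)
    (hcont : ∀ k, ∀ᵐ ω ∂P, Continuous fun t => Y k t ω)
    (hsum : ∀ t, Summable fun k => ∫ ω, Y k t ω ^ 2 ∂P) :
    ∀ᵐ ω ∂P, ∀ t, Summable fun k => Y k t ω ^ 2 := by
  obtain ⟨T, hT⟩ := Filter.exists_seq_tendsto (Filter.atTop : Filter ι)
  have hIic : ∀ᵐ ω ∂P, ∀ n, ∀ t ≤ T n, Summable fun k => Y k t ω ^ 2 :=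
    ae_all_iff.2 fun n => ae_forall_le_summable_sq hY hsq
      ((ae_all_iff.2 hcont).mono fun ω hω k => (hω k).continuousOn) (hsum (T n))
  filter_upwards [hIic] with ω hω t
  obtain ⟨n, hn⟩ := (hT.eventually_ge_atTop t).exists
  exact hω n t hn

lemma exists_martingale_repr_eq {E : Type*} [NormedAddCommGroup E] [InnerProductSpace ℝ E]
    [CompleteSpace E] (b : HilbertBasis ℕ ℝ E) (hY : ∀ k, Martingale (Y k) ℱ P)
    (hsq : ∀ k t, Integrable (fun ω => Y k t ω ^ 2) P)
    (hcont : ∀ k, ∀ᵐ ω ∂P, Continuous fun t => Y k t ω)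
    (hsum : ∀ t, Summable fun k => ∫ ω, Y k t ω ^ 2 ∂P) :
    ∃ X : ι → Ω → E, (∀ᵐ ω ∂P, ∀ t k, b.repr (X t ω) k = Y k t ω) ∧
      Martingale X ℱ P ∧ ∀ t, MemLp (X t) 2 P := by
  let X : ι → Ω → E := fun t ω => ∑' k, Y k t ω • b k
  have hX : StronglyAdapted ℱ X := fun t =>
    stronglyMeasurable_tsum_smul b fun k => (hY k).stronglyAdapted t
  have hrepr : ∀ᵐ ω ∂P, ∀ t k, b.repr (X t ω) k = Y k t ω := by
    filter_upwards [ae_forall_summable_sq hY hsq hcont hsum] with ω hω t k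
    exact repr_tsum_smul b (hω t) k
  have hcoord : ∀ t k, (fun ω => b.repr (X t ω) k) =ᵐ[P] Y k t := fun t k =>
    hrepr.mono fun ω hω => hω t k
  have hcoordSq : ∀ t k, (fun ω => b.repr (X t ω) k ^ 2) =ᵐ[P] fun ω => Y k t ω ^ 2 :=
    fun t k => (hcoord t k).pow_const 2
  have hL2 : ∀ t, MemLp (X t) 2 P := fun t =>
    memLp_two_of_summable_integral_repr_sq b ((hX t).mono (ℱ.le t)).aestronglyMeasurable
      (fun k => (hsq k t).congr (hcoordSq t k).symm)
      ((hsum t).congr fun k => integral_congr_ae (hcoordSq t k).symm)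
  refine ⟨X, hrepr, martingale_of_repr b hX (fun t => (hL2 t).integrable one_le_two)
    fun k => (hY k).congr (fun t => ?_) fun t => (hcoord t k).symm, hL2⟩
  simp only [b.repr_apply_apply]
  exact (innerSL ℝ (b k)).continuous.comp_stronglyMeasurable (hX t)

end HilbertMartingale

lemma PosWeight.pos_of_le_mul_succ (w : PosWeight) {d : ℝ}
    (hd : ∀ k, 1 ≤ k → w k ≤ d * w (k + 1)) : 0 < d :=
  pos_of_mul_pos_left ((w.pos_succ 0).trans_le (hd 1 le_rfl)) (w.pos_succ 1).le

namespace TailSeq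

variable {v : ℕ → ℝ}

lemma nonneg (hv : v ∈ TailSeq) (k : ℕ) : 0 ≤ v k :=
  (antitone_nat_of_succ_le hv.2.1).le_of_tendsto hv.2.2 k

lemma le_one (hv : v ∈ TailSeq) (k : ℕ) : v k ≤ 1 :=
  hv.1 ▸ antitone_nat_of_succ_le hv.2.1 k.zero_le

lemma pow_sub_pow_succ_le (hv : v ∈ TailSeq) (L k : ℕ) : v k ^ L - v (k + 1) ^ L ≤ v k := by
  rcases eq_or_ne L 0 with rfl | hL
  · simpa using nonneg hv k
  · exact (sub_le_self _ (pow_nonneg (nonneg hv (k + 1)) L)).trans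
      (pow_le_of_le_one (nonneg hv k) (le_one hv k) hL)

lemma abs_FPlus_succ_le (hv : v ∈ TailSeq) (α : ℝ) (L k : ℕ) :
    |FPlus α L v (k + 1)| ≤ |α| * v k := by
  have hpow : v (k + 1) ^ L ≤ v k ^ L := pow_le_pow_left₀ (nonneg hv _) (hv.2.1 k) L
  rw [FPlus, abs_mul, abs_of_nonneg (sub_nonneg.2 hpow)]
  exact mul_le_mul_of_nonneg_left (pow_sub_pow_succ_le hv L k) (abs_nonneg α)

lemma abs_FMinus_succ_le (hv : v ∈ TailSeq) (β : ℝ) (k : ℕ) :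
    |FMinus β v (k + 1)| ≤ |β| * v (k + 1) := by
  rw [FMinus, abs_mul, abs_of_nonneg (sub_nonneg.2 (hv.2.1 (k + 1)))]
  exact mul_le_mul_of_nonneg_left (sub_le_self _ (nonneg hv _)) (abs_nonneg β)

variable {w : PosWeight} {d : ℝ}

lemma sum_div_succ_le (hv : v ∈ TailSeq) (hd : ∀ k, 1 ≤ k → w k ≤ d * w (k + 1)) (n : ℕ) :
    ∑ k ∈ Finset.range n, v k / w (k + 1) ≤
      1 / w 1 + d * ∑ k ∈ Finset.range n, v (k + 1) / w (k + 1) := by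
  have hshift : ∀ k, v (k + 1) / w (k + 2) ≤ d * (v (k + 1) / w (k + 1)) := fun k => by
    rw [← mul_div_assoc, div_le_div_iff₀ (w.pos_succ _) (w.pos_succ _), mul_right_comm, mul_comm]
    exact mul_le_mul_of_nonneg_right (hd (k + 1) k.succ_pos) (nonneg hv (k + 1))
  calc ∑ k ∈ Finset.range n, v k / w (k + 1)
      ≤ ∑ k ∈ Finset.range (n + 1), v k / w (k + 1) :=
        Finset.sum_le_sum_of_subset_of_nonneg (Finset.range_mono n.le_succ) fun k _ _ =>
          div_nonneg (nonneg hv k) (w.pos_succ k).le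
    _ = 1 / w 1 + ∑ k ∈ Finset.range n, v (k + 1) / w (k + 2) := by
        rw [Finset.sum_range_succ', hv.1, add_comm]
    _ ≤ 1 / w 1 + d * ∑ k ∈ Finset.range n, v (k + 1) / w (k + 1) := by
        rw [Finset.mul_sum]
        exact add_le_add_right (Finset.sum_le_sum fun k _ => hshift k) _

lemma sum_abs_FPlus_add_abs_FMinus_div_le (hv : v ∈ TailSeq)
    (hd : ∀ k, 1 ≤ k → w k ≤ d * w (k + 1)) (α β : ℝ) (L n : ℕ) :
    ∑ k ∈ Finset.range n, (|FPlus α L v (k + 1)| + |FMinus β v (k + 1)|) / w (k + 1) ≤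
      (|α| * d + |β|) * ∑ k ∈ Finset.range n, v (k + 1) / w (k + 1) + |α| / w 1 :=
  calc ∑ k ∈ Finset.range n, (|FPlus α L v (k + 1)| + |FMinus β v (k + 1)|) / w (k + 1)
      ≤ ∑ k ∈ Finset.range n, (|α| * v k + |β| * v (k + 1)) / w (k + 1) :=
        Finset.sum_le_sum fun k _ => div_le_div_of_nonneg_right
          (add_le_add (abs_FPlus_succ_le hv α L k) (abs_FMinus_succ_le hv β k)) (w.pos_succ k).le
    _ = |α| * ∑ k ∈ Finset.range n, v k / w (k + 1) +
          |β| * ∑ k ∈ Finset.range n, v (k + 1) / w (k + 1) := by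
        simp only [Finset.mul_sum, ← Finset.sum_add_distrib, add_div, mul_div_assoc]
    _ ≤ |α| * (1 / w 1 + d * ∑ k ∈ Finset.range n, v (k + 1) / w (k + 1)) +
          |β| * ∑ k ∈ Finset.range n, v (k + 1) / w (k + 1) :=
        add_le_add_left (mul_le_mul_of_nonneg_left (sum_div_succ_le hv hd n) (abs_nonneg α)) _
    _ = _ := by ring

lemma norm_sum_FPlus_sub_FMinus_div_le (hv : v ∈ TailSeq)
    (hd : ∀ k, 1 ≤ k → w k ≤ d * w (k + 1)) (α β : ℝ) (L n : ℕ) :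
    ‖∑ k ∈ Finset.range n, (FPlus α L v (k + 1) - FMinus β v (k + 1)) / w (k + 1)‖ ≤
      (|α| * d + |β|) * ∑ k ∈ Finset.range n, v (k + 1) / w (k + 1) + |α| / w 1 := by
  refine ((norm_sum_le _ _).trans (Finset.sum_le_sum fun k _ => ?_)).trans
    (sum_abs_FPlus_add_abs_FMinus_div_le hv hd α β L n)
  rw [Real.norm_eq_abs, abs_div, abs_of_pos (w.pos_succ k)]
  exact div_le_div_of_nonneg_right (abs_sub _ _) (w.pos_succ k).le

end TailSeq

namespace IsMeanFieldSolution

variable {α β : ℝ} {L : ℕ} {u : ℝ → ℕ → ℝ}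

lemma continuousOn (hu : IsMeanFieldSolution α β L u) (k : ℕ) :
    ContinuousOn (fun s => u s k) (Set.Ici 0) := by
  cases k with
  | zero => exact (continuousOn_const (c := (1 : ℝ))).congr fun s hs => (hu.mem s hs).1
  | succ k => exact fun s hs => (hu.deriv s hs (k + 1) k.succ_pos).continuousWithinAt

lemma continuousOn_rate (hu : IsMeanFieldSolution α β L u) (k : ℕ) :
    ContinuousOn (fun s => FPlus α L (u s) k + FMinus β (u s) k) (Set.Ici 0) := by
  cases k with
  | zero => simpa only [FPlus, FMinus] using continuousOn_const
  | succ k =>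
    have hcont := hu.continuousOn
    simp only [FPlus, FMinus]
    fun_prop

lemma intervalIntegrable_rate (hu : IsMeanFieldSolution α β L u) (k : ℕ) {t : ℝ} (ht : 0 ≤ t) :
    IntervalIntegrable (fun s => FPlus α L (u s) k + FMinus β (u s) k) volume 0 t :=
  ((hu.continuousOn_rate k).mono (Set.uIcc_of_le ht ▸ Set.Icc_subset_Ici_self)).intervalIntegrable

variable {w : PosWeight} {d : ℝ}

lemma exists_forall_sum_div_le (hu : IsMeanFieldSolution α β L u)
    (hd : ∀ k, 1 ≤ k → w k ≤ d * w (k + 1)) (hu0 : w.EllOneSummable (u 0)) (T : ℝ) :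
    ∃ C, ∀ s ∈ Set.Icc 0 T, ∀ n, ∑ k ∈ Finset.range n, u s (k + 1) / w (k + 1) ≤ C := by
  have hd0 : 0 < d := w.pos_of_le_mul_succ hd
  have hw1 : 0 < w 1 := w.pos_succ 0
  have habs : ∀ k, 0 ≤ |u 0 (k + 1)| / w (k + 1) := fun k =>
    div_nonneg (abs_nonneg _) (w.pos_succ k).le
  let N : ℕ → ℝ → ℝ := fun n s => ∑ k ∈ Finset.range n, u s (k + 1) / w (k + 1)
  let N' : ℕ → ℝ → ℝ := fun n s => ∑ k ∈ Finset.range n,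
    (FPlus α L (u s) (k + 1) - FMinus β (u s) (k + 1)) / w (k + 1)
  have hcont : ∀ n, ContinuousOn (N n) (Set.Icc 0 T) := fun n =>
    (continuousOn_finsetSum _ fun k _ => (hu.continuousOn (k + 1)).div_const _).mono
      Set.Icc_subset_Ici_self
  have hderiv : ∀ n, ∀ s ∈ Set.Ico 0 T, HasDerivWithinAt (N n) (N' n s) (Set.Ici s) s :=
    fun n s hs => HasDerivWithinAt.fun_sum fun k _ =>
      ((hu.deriv s hs.1 (k + 1) k.succ_pos).mono (Set.Ici_subset_Ici.2 hs.1)).div_const _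
  have hinit : ∀ n, ‖N n 0‖ ≤ ∑' k, |u 0 (k + 1)| / w (k + 1) := fun n =>
    ((norm_sum_le _ _).trans_eq (Finset.sum_congr rfl fun k _ => by
      rw [Real.norm_eq_abs, abs_div, abs_of_pos (w.pos_succ k)])).trans
      (hu0.sum_le_tsum _ fun k _ => habs k)
  have hgrowth : ∀ n, ∀ s ∈ Set.Ico 0 T, ‖N' n s‖ ≤ (|α| * d + |β|) * ‖N n s‖ + |α| / w 1 :=
    fun n s hs =>
      (TailSeq.norm_sum_FPlus_sub_FMinus_div_le (hu.mem s hs.1) hd α β L n).trans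
        (by gcongr; exact Real.le_norm_self _)
  refine ⟨gronwallBound (∑' k, |u 0 (k + 1)| / w (k + 1)) (|α| * d + |β|) (|α| / w 1) (T - 0),
    fun s hs n => ?_⟩
  calc N n s
      ≤ ‖N n s‖ := Real.le_norm_self _
    _ ≤ gronwallBound _ (|α| * d + |β|) (|α| / w 1) (s - 0) :=
        norm_le_gronwallBound_of_norm_deriv_right_le (hcont n) (hderiv n) (hinit n) (hgrowth n) s hs
    _ ≤ _ := gronwallBound_mono (tsum_nonneg habs) (by positivity) (by positivity)
        (sub_le_sub_right hs.2 0)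

lemma summable_integral_rate_div (hu : IsMeanFieldSolution α β L u)
    (hd : ∀ k, 1 ≤ k → w k ≤ d * w (k + 1)) (hu0 : w.EllOneSummable (u 0)) {t : ℝ} (ht : 0 ≤ t) :
    Summable fun k =>
      (∫ s in (0 : ℝ)..t, (FPlus α L (u s) (k + 1) + FMinus β (u s) (k + 1))) / w (k + 1) := by
  obtain ⟨C, hC⟩ := hu.exists_forall_sum_div_le hd hu0 t
  have hd0 : 0 < d := w.pos_of_le_mul_succ hd
  let r : ℕ → ℝ → ℝ := fun k s =>
    |FPlus α L (u s) (k + 1) + FMinus β (u s) (k + 1)| / w (k + 1)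
  have hr : ∀ k, IntervalIntegrable (r k) volume 0 t := fun k =>
    (hu.intervalIntegrable_rate (k + 1) ht).abs.div_const _
  have hrsum : ∀ n, IntervalIntegrable (fun s => ∑ k ∈ Finset.range n, r k s) volume 0 t :=
    fun n => by simpa only [Finset.sum_fn] using IntervalIntegrable.sum _ fun k _ => hr k
  have hr0 : ∀ k s, 0 ≤ r k s := fun k s => div_nonneg (abs_nonneg _) (w.pos_succ k).le
  have hsum : ∀ s ∈ Set.Icc 0 t, ∀ n,
      ∑ k ∈ Finset.range n, r k s ≤ (|α| * d + |β|) * C + |α| / w 1 := fun s hs n =>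
    (Finset.sum_le_sum fun k _ => div_le_div_of_nonneg_right (abs_add_le _ _)
      (w.pos_succ k).le).trans ((TailSeq.sum_abs_FPlus_add_abs_FMinus_div_le
        (hu.mem s hs.1) hd α β L n).trans (by gcongr; exact hC s hs n))
  have hsummable : Summable fun k => ∫ s in (0 : ℝ)..t, r k s :=
    summable_of_sum_range_le (fun k => intervalIntegral.integral_nonneg ht fun s _ => hr0 k s)
      fun n => by
        rw [← intervalIntegral.integral_finsetSum fun k _ => hr k]
        exact intervalIntegral.integral_mono_on ht (hrsum n) intervalIntegrable_const
          fun s hs => hsum s hs n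
  refine hsummable.of_norm_bounded fun k => ?_
  rw [norm_div, Real.norm_of_nonneg (w.pos_succ k).le, intervalIntegral.integral_div]
  exact div_le_div_of_nonneg_right (intervalIntegral.norm_integral_le_integral_norm ht)
    (w.pos_succ k).le

end IsMeanFieldSolution

section Bracket

variable {Ω ι : Type*} {mΩ : MeasurableSpace Ω} {P : Measure Ω}

lemma integrable_sq_of_martingale_bracket [IsFiniteMeasure P] [Preorder ι] {ℱ : Filtration ι mΩ}
    {m : ι → Ω → ℝ} {a : ι → ℝ} (hbracket : Martingale (fun t ω => m t ω ^ 2 - a t) ℱ P) (t : ι) :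
    Integrable (fun ω => m t ω ^ 2) P :=
  ((hbracket.integrable t).add (integrable_const (a t))).congr
    (ae_of_all _ fun _ => sub_add_cancel _ _)

lemma integral_sq_eq_of_martingale_bracket [IsProbabilityMeasure P] [Preorder ι] [OrderBot ι]
    {ℱ : Filtration ι mΩ} {m : ι → Ω → ℝ} {a : ι → ℝ}
    (hbracket : Martingale (fun t ω => m t ω ^ 2 - a t) ℱ P) (hm : ∀ᵐ ω ∂P, m ⊥ ω = 0)
    (ha : a ⊥ = 0) (t : ι) : ∫ ω, m t ω ^ 2 ∂P = a t := by
  have hbot : ∫ ω, (m ⊥ ω ^ 2 - a ⊥) ∂P = 0 :=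
    integral_eq_zero_of_ae (hm.mono fun ω hω => by simp [hω, ha])
  have hmean : ∫ ω, (m t ω ^ 2 - a t) ∂P = ∫ ω, (m ⊥ ω ^ 2 - a ⊥) ∂P := by
    simpa only [setIntegral_univ] using
      (hbracket.setIntegral_eq (bot_le : ⊥ ≤ t) MeasurableSet.univ).symm
  rw [hbot, integral_sub (integrable_sq_of_martingale_bracket hbracket t) (integrable_const _),
    integral_const, probReal_univ, one_smul] at hmean
  exact sub_eq_zero.1 hmean

lemma ae_forall_eq_zero_of_integral_sq_eq_zero [TopologicalSpace ι]
    [TopologicalSpace.SeparableSpace ι] {m : ι → Ω → ℝ}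
    (hint : ∀ t, Integrable (fun ω => m t ω ^ 2) P) (hm : ∀ t, ∫ ω, m t ω ^ 2 ∂P = 0)
    (hcont : ∀ᵐ ω ∂P, Continuous fun t => m t ω) : ∀ᵐ ω ∂P, ∀ t, m t ω = 0 := by
  obtain ⟨D, hD, hdense⟩ := TopologicalSpace.exists_countable_dense ι
  have hzero : ∀ᵐ ω ∂P, ∀ t ∈ D, m t ω = 0 := (ae_ball_iff hD).2 fun t _ =>
    ((integral_eq_zero_iff_of_nonneg (fun ω => sq_nonneg _) (hint t)).1 (hm t)).mono
      fun ω hω => (pow_eq_zero_iff two_ne_zero).1 hω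
  filter_upwards [hzero, hcont] with ω hω hc
  exact congrFun (hc.ext_on hdense continuous_const hω)

end Bracket

/-- The orthonormal basis `(√w(k+1) e(k+1))_{k ≥ 0}` of `L₂(w)`, indexed from `0` like the standard
basis of `ℓ²` from which it is transported. -/
noncomputable def PosWeight.L2.hilbertBasis (w : PosWeight) : HilbertBasis ℕ ℝ w.L2 :=
  .ofRepr (.ofSurjective (toEllTwo w) toEllTwo_surjective)

lemma PosWeight.L2.hilbertBasis_repr_apply {w : PosWeight} (x : w.L2) (k : ℕ) :
    (hilbertBasis w).repr x k = x (k + 1) / √(w (k + 1)) := rfl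

theorem mainTheorem4_general {Ω : Type*} [MeasurableSpace Ω] (P : Measure Ω)
    [IsProbabilityMeasure P] (α β : ℝ) (L : ℕ) (w : PosWeight) {d : ℝ}
    (hd : ∀ k, 1 ≤ k → w k ≤ d * w (k + 1))
    (u : ℝ → ℕ → ℝ) (hu : IsMeanFieldSolution α β L u) (hu0 : w.EllOneSummable (u 0))
    (M : ℕ → ℝ≥0 → Ω → ℝ) (hM : ∀ k t, StronglyMeasurable (M k t))
    (hindep : iIndepFun (fun k ω t => M k t ω) P)
    (hcont : ∀ k, ∀ᵐ ω ∂P, Continuous fun t => M k t ω)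
    (hnull : ∀ k, ∀ᵐ ω ∂P, M k 0 ω = 0)
    (hmart : ∀ k, Martingale (M k) (Filtration.natural (M k) (hM k)) P)
    (hbracket : ∀ k, Martingale
      (fun t ω => M k t ω ^ 2 - ∫ s in (0 : ℝ)..t, (FPlus α L (u s) k + FMinus β (u s) k))
      (Filtration.natural (M k) (hM k)) P) :
    ∃ X : ℝ≥0 → Ω → w.L2,
      (∀ᵐ ω ∂P, ∀ t k, X t ω k = M k t ω) ∧
      Martingale X (jointFiltration M hM) P ∧
      ∀ t, MemLp (X t) 2 P := by
  have hsq : ∀ k t, Integrable (fun ω => M k t ω ^ 2) P := fun k =>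
    integrable_sq_of_martingale_bracket (hbracket k)
  have hvar : ∀ k (t : ℝ≥0), ∫ ω, M k t ω ^ 2 ∂P =
      ∫ s in (0 : ℝ)..t, (FPlus α L (u s) k + FMinus β (u s) k) := fun k =>
    integral_sq_eq_of_martingale_bracket (hbracket k) (hnull k) intervalIntegral.integral_same
  have hzero : ∀ᵐ ω ∂P, ∀ t, M 0 t ω = 0 := ae_forall_eq_zero_of_integral_sq_eq_zero (hsq 0)
    (fun t => by simp only [hvar, FPlus, FMinus, add_zero, intervalIntegral.integral_zero])
    (hcont 0)
  have hscaled : ∀ k t ω, (M (k + 1) t ω / √(w (k + 1))) ^ 2 = M (k + 1) t ω ^ 2 / w (k + 1) :=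
    fun k t ω => by rw [div_pow, Real.sq_sqrt (w.pos_succ k).le]
  obtain ⟨X, hX, hXmart, hXsq⟩ := exists_martingale_repr_eq (PosWeight.L2.hilbertBasis w)
    (Y := fun k t ω => M (k + 1) t ω / √(w (k + 1))) (ℱ := jointFiltration M hM) (P := P)
    (fun k => by
      simpa only [div_eq_inv_mul] using!
        (martingale_jointFiltration hM hindep (hmart (k + 1))).smul (√(w (k + 1)))⁻¹)
    (fun k t => by simpa only [hscaled] using (hsq (k + 1) t).div_const _)
    (fun k => (hcont (k + 1)).mono fun ω hω => hω.div_const _)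
    (fun t => by
      simpa only [hscaled, integral_div, hvar]
        using hu.summable_integral_rate_div hd hu0 t.coe_nonneg)
  refine ⟨X, ?_, hXmart, hXsq⟩
  filter_upwards [hX, hzero] with ω hω hω0 t k
  cases k with
  | zero => rw [hω0 t, PosWeight.L2.apply_zero]
  | succ k =>
    simpa only [PosWeight.L2.hilbertBasis_repr_apply,
      div_left_inj' (Real.sqrt_pos.2 (w.pos_succ k)).ne'] using hω t k

theorem mainTheorem4 {Ω : Type*} [MeasurableSpace Ω] (P : Measure Ω) [IsProbabilityMeasure P]
    (α β : ℝ) (hα : 0 < α) (hβ : 0 < β) (L : ℕ) (hL : 1 ≤ L)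
    (w : PosWeight) (hw : w.Comparable)
    (u : ℝ → ℕ → ℝ) (hu : IsMeanFieldSolution α β L u) (hu0 : w.EllOneSummable (u 0))
    (M : ℕ → ℝ≥0 → Ω → ℝ) (hM : IsLimitMartingale P α β L u M) :
    ∃ X : ℝ≥0 → Ω → w.L2,
      (∀ᵐ ω ∂P, ∀ t k, X t ω k = M k t ω) ∧
      Martingale X (jointFiltration M hM.stronglyMeasurable) P ∧
      ∀ t, MemLp (X t) 2 P := by
  obtain ⟨_, d, _, _, hw⟩ := hw
  exact mainTheorem4_general P α β L w (fun k hk => (hw k hk).2) u hu hu0 M hM.stronglyMeasurable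
    hM.indep hM.continuous hM.null_at_zero hM.martingale hM.bracket
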